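/- There is an absolute constant $C>0$ such that the following holds for every $n\ge 0$, every $\epsilon\in(0,1]$ and every submodular function $f:\{0,1\}^n\to[0,1]$, that is, every $f$ with $f(x\vee y)+f(x\wedge y)\le f(x)+f(y)$ for all $x,y\in\{0,1\}^n$, where $\vee$ and $\wedge$ are the coordinatewise maximum and minimum. There is a real polynomial $p$ in $n$ variables of total degree at most $C\,\epsilon^{-4/5}\log(1/\epsilon)$ such that $\|f-p\|_2\le\epsilon$, where $\|g\|_2=\bigl(2^{-n}\sum_{x\in\{0,1\}^n}g(x)^2\bigr)^{1/2}$ is the $\ell_2$ norm with respect to the uniform distribution on $\{0,1\}^n$. -/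

import Mathlib

/-- A point of the Boolean cube `{0,1}^n`, with `true` for `1` and `false` for `0`.
The union and the intersection of subsets of `[n]` are the coordinatewise `⊔` and `⊓`. -/
abbrev Cube (n : ℕ) : Type := Fin n → Bool

/-- A real function on `{0,1}^n` (equivalently, a set function on `[n]`) is submodular if
`f (A ∪ B) + f (A ∩ B) ≤ f A + f B` for all `A, B`. -/
def CubeSubmodular {n : ℕ} (f : Cube n → ℝ) : Prop :=
  ∀ x y : Cube n, f (x ⊔ y) + f (x ⊓ y) ≤ f x + f y

/-- The `ℓ₂` norm with respect to the uniform distribution on `{0,1}^n`: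
`‖f‖₂ = (E_x [f(x)^2])^{1/2}`. -/
noncomputable def cubeL2Norm {n : ℕ} (f : Cube n → ℝ) : ℝ :=
  Real.sqrt ((∑ x : Cube n, f x ^ 2) / 2 ^ n)

/-- The function on `{0,1}^n` given by a real polynomial in `n` variables. -/
noncomputable def polyOnCube {n : ℕ} (p : MvPolynomial (Fin n) ℝ) (x : Cube n) : ℝ :=
  MvPolynomial.eval (fun i => if x i then (1 : ℝ) else 0) p

/-!
Submodularity says that the discrete derivatives `D_i f` are antitone, and since `f` takes values
in an interval of length one, the positive parts of the derivatives in the directions of the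
elements of `x` sum to at most one at `x`.

*Few coordinates have large derivatives.* If `D_i f` is larger than `a` at the join of `k` points,
then it is so at each of them. Choose the bias `p ≈ 1 / k` for which the join of `k` independent
points has bias `1 / 4`. At bias `p` all but `O(k / a)` of the derivatives exceed `a` with
probability at most `1 / 4`, and these do so with probability at most `4 ^ (-k)` at bias `1 / 4`.
Complementation gives the same for `-D_i f`. Let `J` be the set of the `O(k / a)` exceptional
coordinates. For `k` of order `log (1 / a)`, the sum `Ψ` over `i ∉ J` of the signed `3 / 2`-th
powers of `D_i f` satisfies `E Ψ ^ 2 = O(a)`.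

*Second derivatives.* For a second derivative `-D_j D_i f = h ≥ 0` write `h ^ 2 = √h * h ^ (3 / 2)`.
Here `√h` is at most the square root of the drop of `D_j f` from the meet to the join of two points
that differ in the coordinate `i`, and `h ^ (3 / 2)` is at most `4` times the decrease in the
direction `j` of the signed power of `D_i f`. Exchanging the `j`-th coordinates of two independent
points fixes the first factor, so an integration by parts and the Cauchy-Schwarz inequality give
`∑ i ∉ J, ∑ j ∉ J, E (D_j D_i f) ^ 2 = O((E Ψ ^ 2) ^ (1 / 2)) = O(√a)`.

*Walsh tail.* A Walsh function whose index has more than `d` elements outside `J` contributes at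
least `16 * d ^ 2` times its squared coefficient to this sum. Discarding all of these for `d` of
order `1 / a` leaves a polynomial of degree `O(log (1 / a) / a)` with squared error
`O(a ^ (5 / 2))`, and `a = ε ^ (4 / 5)` turns this into `O(ε ^ 2)`.
-/

open Finset Function
open scoped BigOperators

section BernoulliExpectation

variable {ι : Type*} [DecidableEq ι]

/-- The point of the cube obtained by negating the coordinate `i`. -/
def flipCoord (i : ι) (x : ι → Bool) : ι → Bool := update x i (!x i)

lemma flipCoord_self (i : ι) (x : ι → Bool) : flipCoord i x i = !x i := by
  simp [flipCoord]

lemma flipCoord_of_ne {i j : ι} (h : j ≠ i) (x : ι → Bool) : flipCoord i x j = x j := by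
  simp [flipCoord, h]

lemma flipCoord_involutive (i : ι) : Involutive (flipCoord i) := by
  intro x
  simp [flipCoord]

lemma flipCoord_eq_of_dependsOn {α : Type*} {i : ι} {g : (ι → Bool) → α} (hg : DependsOn g {i}ᶜ)
    (x : ι → Bool) : g (flipCoord i x) = g x :=
  hg fun _ hj => flipCoord_of_ne hj x

variable [Fintype ι]

lemma sum_coord_mul {i : ι} (c : Bool → ℝ) {g : (ι → Bool) → ℝ} (hg : DependsOn g {i}ᶜ) :
    ∑ x, c (x i) * g x = (c true + c false) / 2 * ∑ x, g x := by
  have hflip : ∑ x, c (!x i) * g x = ∑ x, c (x i) * g x := by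
    rw [← Equiv.sum_comp (flipCoord_involutive i).toPerm]
    simp [flipCoord_self, flipCoord_eq_of_dependsOn hg]
  have hpair (b : Bool) : c b + c (!b) = c true + c false := by
    cases b <;> simp [add_comm]
  have hsum : ∑ x, c (x i) * g x + ∑ x, c (!x i) * g x = (c true + c false) * ∑ x, g x := by
    rw [← sum_add_distrib, mul_sum]
    exact sum_congr rfl fun x _ => by rw [← add_mul, hpair]
  linarith

lemma sum_prod_coord (c : ι → Bool → ℝ) :
    ∑ x : ι → Bool, ∏ i, c i (x i) = ∏ i, (c i true + c i false) := by
  simpa using (Fintype.prod_sum c).symm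

/-- The mass that the Bernoulli distribution with parameter `p` gives to `b`. -/
def bernoulliWeight (p : ℝ) (b : Bool) : ℝ := if b then p else 1 - p

/-- The expectation of `g` at a random point of the cube whose coordinates are independent and equal
to `true` with probability `p`. -/
noncomputable def bernoulliExpect (p : ℝ) (g : (ι → Bool) → ℝ) : ℝ :=
  ∑ x, (∏ i, bernoulliWeight p (x i)) * g x

lemma bernoulliWeight_nonneg {p : ℝ} (hp : p ∈ Set.Icc 0 1) (b : Bool) :
    0 ≤ bernoulliWeight p b := by
  cases b
  · simpa [bernoulliWeight] using hp.2
  · simpa [bernoulliWeight] using hp.1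

lemma bernoulliExpect_mono {p : ℝ} (hp : p ∈ Set.Icc 0 1) {g h : (ι → Bool) → ℝ} (hgh : g ≤ h) :
    bernoulliExpect p g ≤ bernoulliExpect p h :=
  sum_le_sum fun x _ =>
    mul_le_mul_of_nonneg_left (hgh x) (prod_nonneg fun _ _ => bernoulliWeight_nonneg hp _)

lemma bernoulliExpect_nonneg {p : ℝ} (hp : p ∈ Set.Icc 0 1) {g : (ι → Bool) → ℝ} (hg : 0 ≤ g) :
    0 ≤ bernoulliExpect p g :=
  sum_nonneg fun x _ => mul_nonneg (prod_nonneg fun _ _ => bernoulliWeight_nonneg hp _) (hg x)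

lemma bernoulliExpect_sum {κ : Type*} (s : Finset κ) (p : ℝ) (g : κ → (ι → Bool) → ℝ) :
    bernoulliExpect p (fun x => ∑ i ∈ s, g i x) = ∑ i ∈ s, bernoulliExpect p (g i) := by
  simp only [bernoulliExpect, mul_sum]
  exact sum_comm

lemma bernoulliExpect_const_mul (p c : ℝ) (g : (ι → Bool) → ℝ) :
    bernoulliExpect p (fun x => c * g x) = c * bernoulliExpect p g := by
  simp only [bernoulliExpect, mul_sum, mul_left_comm]

lemma bernoulliExpect_const (p c : ℝ) : bernoulliExpect p (fun _ : ι → Bool => c) = c := by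
  rw [bernoulliExpect, ← sum_mul, sum_prod_coord fun _ => bernoulliWeight p]
  simp [bernoulliWeight]

lemma bernoulliExpect_half (g : (ι → Bool) → ℝ) : bernoulliExpect (1 / 2) g = 𝔼 x, g x := by
  have hw (b : Bool) : bernoulliWeight (1 / 2) b = 1 / 2 := by
    cases b <;> norm_num [bernoulliWeight]
  simp only [bernoulliExpect, hw, ← mul_sum]
  simp [Fintype.expect_eq_sum_div_card, div_eq_inv_mul]

lemma bernoulliExpect_compl (p : ℝ) (g : (ι → Bool) → ℝ) :
    bernoulliExpect p (fun x => g xᶜ) = bernoulliExpect (1 - p) g := by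
  have hw (b : Bool) : bernoulliWeight p (!b) = bernoulliWeight (1 - p) b := by
    cases b <;> simp [bernoulliWeight]
  rw [bernoulliExpect, ← Equiv.sum_comp (compl_involutive (α := ι → Bool)).toPerm]
  simp [bernoulliExpect, hw]

lemma expect_comp_compl (g : (ι → Bool) → ℝ) : 𝔼 x, g xᶜ = 𝔼 x, g x :=
  Fintype.expect_bijective _ compl_bijective _ _ fun _ => rfl

lemma bernoulliExpect_coord_mul {i : ι} (p : ℝ) (c : Bool → ℝ) {g : (ι → Bool) → ℝ}
    (hg : DependsOn g {i}ᶜ) :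
    bernoulliExpect p (fun x => c (x i) * g x)
      = (p * c true + (1 - p) * c false) * bernoulliExpect p g := by
  set R : (ι → Bool) → ℝ := fun x => (∏ j ∈ univ.erase i, bernoulliWeight p (x j)) * g x
  have hR : DependsOn R {i}ᶜ := fun x y h =>
    congrArg₂ _ (prod_congr rfl fun j hj => by rw [h j (ne_of_mem_erase hj)]) (hg h)
  have hsplit (c : Bool → ℝ) : bernoulliExpect p (fun x => c (x i) * g x)
      = (p * c true + (1 - p) * c false) / 2 * ∑ x, R x := by
    trans ∑ x, bernoulliWeight p (x i) * c (x i) * R x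
    · refine sum_congr rfl fun x _ => ?_
      rw [← mul_prod_erase univ _ (mem_univ i)]
      ring
    · simpa [bernoulliWeight] using sum_coord_mul (fun b => bernoulliWeight p b * c b) hR
  have hone := hsplit fun _ => 1
  simp only [one_mul] at hone
  rw [hone, hsplit]
  ring

lemma expect_coord_mul {i : ι} (c : Bool → ℝ) {g : (ι → Bool) → ℝ} (hg : DependsOn g {i}ᶜ) :
    𝔼 x, c (x i) * g x = (c true + c false) / 2 * 𝔼 x, g x := by
  rw [← bernoulliExpect_half, ← bernoulliExpect_half, bernoulliExpect_coord_mul _ _ hg]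
  ring

lemma bernoulliExpect_bernoulliExpect (φ : Bool → Bool → Bool) {p q r : ℝ}
    (hr : ∀ c, bernoulliWeight r c
      = ∑ a, ∑ b, if φ a b = c then bernoulliWeight p a * bernoulliWeight q b else 0)
    (g : (ι → Bool) → ℝ) :
    bernoulliExpect p (fun x => bernoulliExpect q fun y => g fun i => φ (x i) (y i))
      = bernoulliExpect r g := by
  have hprod (z : ι → Bool) : ∏ i, bernoulliWeight r (z i)
      = ∑ x : ι → Bool, ∑ y : ι → Bool, if (fun i => φ (x i) (y i)) = z then
        (∏ i, bernoulliWeight p (x i)) * ∏ i, bernoulliWeight q (y i) else 0 := by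
    simp only [hr, Fintype.prod_sum, prod_ite_zero, prod_mul_distrib, funext_iff, mem_univ,
      true_implies]
  simp only [bernoulliExpect, hprod, sum_mul]
  rw [sum_comm]
  refine sum_congr rfl fun x _ => ?_
  rw [sum_comm, mul_sum]
  refine sum_congr rfl fun y _ => ?_
  simp [ite_mul, mul_assoc]

lemma bernoulliExpect_bernoulliExpect_inf (p q : ℝ) (g : (ι → Bool) → ℝ) :
    bernoulliExpect p (fun x => bernoulliExpect q fun y => g (x ⊓ y))
      = bernoulliExpect (p * q) g := by
  refine bernoulliExpect_bernoulliExpect (fun a b => a ⊓ b) (fun c => ?_) g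
  cases c <;> simp [bernoulliWeight]; ring

lemma bernoulliExpect_bernoulliExpect_sup (p q : ℝ) (g : (ι → Bool) → ℝ) :
    bernoulliExpect p (fun x => bernoulliExpect q fun y => g (x ⊔ y))
      = bernoulliExpect (1 - (1 - p) * (1 - q)) g := by
  refine bernoulliExpect_bernoulliExpect (fun a b => a ⊔ b) (fun c => ?_) g
  cases c <;> simp [bernoulliWeight]; ring

lemma expect_expect_inf (g : (ι → Bool) → ℝ) :
    𝔼 x, 𝔼 y, g (x ⊓ y) = bernoulliExpect (1 / 4) g := by
  simp only [← bernoulliExpect_half, bernoulliExpect_bernoulliExpect_inf]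
  norm_num

lemma expect_expect_sup (g : (ι → Bool) → ℝ) :
    𝔼 x, 𝔼 y, g (x ⊔ y) = bernoulliExpect (3 / 4) g := by
  simp only [← bernoulliExpect_half, bernoulliExpect_bernoulliExpect_sup]
  norm_num

-- The join of `k` independent points of bias `p` has bias `1 - (1 - p) ^ k`.
lemma bernoulliExpect_le_pow {g : (ι → Bool) → ℝ} (hg0 : 0 ≤ g) (hg1 : g ≤ 1)
    (hsup : ∀ x y, g (x ⊔ y) ≤ g x * g y) {p : ℝ} (hp : p ∈ Set.Icc 0 1) (k : ℕ) :
    bernoulliExpect (1 - (1 - p) ^ k) g ≤ bernoulliExpect p g ^ k := by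
  induction k with
  | zero =>
    have h := bernoulliExpect_mono (p := 1 - (1 - p) ^ 0) (by simp) hg1
    simpa [Pi.one_def, bernoulliExpect_const] using h
  | succ k ih =>
    set q := 1 - (1 - p) ^ k with hq
    have hq01 : q ∈ Set.Icc 0 1 := by
      have h0 := pow_nonneg (sub_nonneg.2 hp.2) k
      have h1 := pow_le_one₀ (n := k) (sub_nonneg.2 hp.2) (sub_le_self 1 hp.1)
      exact ⟨sub_nonneg.2 h1, sub_le_self 1 h0⟩
    have hbias : 1 - (1 - p) ^ (k + 1) = 1 - (1 - q) * (1 - p) := by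
      rw [hq]
      ring
    calc bernoulliExpect (1 - (1 - p) ^ (k + 1)) g
        = bernoulliExpect q fun x => bernoulliExpect p fun y => g (x ⊔ y) := by
          rw [hbias, bernoulliExpect_bernoulliExpect_sup]
      _ ≤ bernoulliExpect q fun x => bernoulliExpect p fun y => g x * g y :=
          bernoulliExpect_mono hq01 fun x => bernoulliExpect_mono hp fun y => hsup x y
      _ = bernoulliExpect p g * bernoulliExpect q g := by
          simp only [bernoulliExpect_const_mul, mul_comm _ (bernoulliExpect p g)]
      _ ≤ bernoulliExpect p g * bernoulliExpect p g ^ k :=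
          mul_le_mul_of_nonneg_left ih (bernoulliExpect_nonneg hp hg0)
      _ = bernoulliExpect p g ^ (k + 1) := (pow_succ' _ _).symm

end BernoulliExpectation

section SecondMoment

variable {ι : Type*} [DecidableEq ι]

lemma dependsOn_update {α : Type*} (g : (ι → Bool) → α) (i : ι) (b : Bool) :
    DependsOn (fun x => g (update x i b)) {i}ᶜ := by
  intro x y h
  refine congrArg g (funext fun j => ?_)
  rcases eq_or_ne j i with rfl | hj
  · simp
  · simp [hj, h j hj]

variable [Fintype ι]

lemma antitone_expect_inf {P : (ι → Bool) → ℝ} (hP : Antitone P) :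
    Antitone fun x => 𝔼 y, P (x ⊓ y) :=
  fun _ _ h => expect_le_expect fun _ _ => hP (inf_le_inf_right _ h)

lemma expect_update_false_inf_le {P : (ι → Bool) → ℝ} (hP : 0 ≤ P) (x : ι → Bool) (i : ι) :
    𝔼 y, P (update x i false ⊓ y) ≤ 2 * 𝔼 y, P (update x i true ⊓ y) := by
  have hfalse (y : ι → Bool) : update x i false ⊓ y = x ⊓ update y i false := by
    ext j
    rcases eq_or_ne j i with rfl | hj <;> simp [*]
  have htrue (y : ι → Bool) (hy : y i = false) : update x i true ⊓ y = x ⊓ update y i false := by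
    ext j
    rcases eq_or_ne j i with rfl | hj <;> simp [*]
  have hhalf := expect_coord_mul (fun b => if b then 0 else 1)
    (dependsOn_update (fun y => P (x ⊓ y)) i false)
  calc 𝔼 y, P (update x i false ⊓ y)
      = 2 * 𝔼 y, (if y i then 0 else 1) * P (x ⊓ update y i false) := by
        rw [hhalf]
        simp [hfalse]
    _ ≤ 2 * 𝔼 y, P (update x i true ⊓ y) := by
        gcongr with y
        cases hy : y i
        · simp [htrue y hy]
        · simpa using hP _

lemma expect_mul_le_four_mul_expect_ite {Q G : (ι → Bool) → ℝ} {i : ι} (hQ : Antitone Q)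
    (hQi : ∀ x, Q (update x i false) ≤ 2 * Q (update x i true)) (hG : 0 ≤ G)
    (hGi : DependsOn G {i}ᶜ) :
    𝔼 x, Q x * G x ≤ 4 * 𝔼 x, if x i then Q x * G x else 0 := by
  have hQle (x : ι → Bool) : Q x ≤ 2 * Q (update x i true) :=
    (hQ (update_le_self_iff.2 (Bool.false_le _))).trans (hQi x)
  have hdep : DependsOn (fun x => Q (update x i true) * G x) {i}ᶜ := fun x y h =>
    congrArg₂ _ (dependsOn_update Q i true h) (hGi h)
  have hhalf := expect_coord_mul (fun b => if b then 1 else 0) hdep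
  calc 𝔼 x, Q x * G x ≤ 𝔼 x, 2 * (Q (update x i true) * G x) :=
        expect_le_expect fun x _ => by
          rw [← mul_assoc]
          exact mul_le_mul_of_nonneg_right (hQle x) (hG x)
    _ = 4 * 𝔼 x, (if x i then 1 else 0) * (Q (update x i true) * G x) := by
        rw [hhalf, ← mul_expect]
        norm_num
        ring
    _ = 4 * 𝔼 x : ι → Bool, if x i then Q x * G x else 0 := by
        congr! 2 with x
        split_ifs with hx
        · rw [← hx, update_eq_self, one_mul]
        · rw [zero_mul]

-- Replacing one factor of the square by its average over random subsets costs nothing by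
-- antitonicity, and makes it insensitive, up to a factor of two, to adding a coordinate.
lemma expect_sq_sum_le_bernoulliExpect {I : Finset ι} {g : ι → (ι → Bool) → ℝ}
    (hg : ∀ i ∈ I, 0 ≤ g i) (hanti : ∀ i ∈ I, Antitone (g i))
    (hdep : ∀ i ∈ I, DependsOn (g i) {i}ᶜ) (hsum : ∀ x, ∑ i ∈ I with x i, g i x ≤ 1) :
    𝔼 x, (∑ i ∈ I, g i x) ^ 2 ≤ 4 * bernoulliExpect (1 / 4) (fun x => ∑ i ∈ I, g i x) := by
  set P : (ι → Bool) → ℝ := fun x => ∑ i ∈ I, g i x with hPdef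
  set Q : (ι → Bool) → ℝ := fun x => 𝔼 y, P (x ⊓ y) with hQdef
  have hP0 : 0 ≤ P := fun x => sum_nonneg fun i hi => hg i hi x
  have hP : Antitone P := fun x y h => sum_le_sum fun i hi => hanti i hi h
  have hQ0 : 0 ≤ Q := fun x => expect_nonneg fun y _ => hP0 _
  have hPQ : P ≤ Q := fun x => by
    rw [← Fintype.expect_const (ι := ι → Bool) (P x)]
    exact expect_le_expect fun y _ => hP inf_le_left
  calc 𝔼 x, P x ^ 2 ≤ 𝔼 x, Q x * P x := expect_le_expect fun x _ => by
        rw [sq]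
        exact mul_le_mul_of_nonneg_right (hPQ x) (hP0 x)
    _ = ∑ i ∈ I, 𝔼 x, Q x * g i x := by
        simp only [hPdef, mul_sum, expect_sum_comm]
    _ ≤ ∑ i ∈ I, 4 * 𝔼 x, if x i then Q x * g i x else 0 := sum_le_sum fun i hi =>
        expect_mul_le_four_mul_expect_ite (antitone_expect_inf hP)
          (expect_update_false_inf_le hP0 · i) (hg i hi) (hdep i hi)
    _ = 4 * 𝔼 x, Q x * ∑ i ∈ I with x i, g i x := by
        rw [← mul_sum, ← expect_sum_comm]
        simp only [mul_sum, sum_filter, mul_ite, mul_zero]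
    _ ≤ 4 * 𝔼 x, Q x := by
        gcongr with x
        exact mul_le_of_le_one_right (hQ0 x) (hsum x)
    _ = 4 * bernoulliExpect (1 / 4) P := by rw [hQdef, expect_expect_inf]

end SecondMoment

section DiscreteDerivative

variable {ι : Type*} [DecidableEq ι]

/-- The discrete derivative of `f` in the direction of the coordinate `i`: the marginal value of `i`
when `f` is regarded as a set function. -/
def cubeDeriv (f : (ι → Bool) → ℝ) (i : ι) (x : ι → Bool) : ℝ :=
  f (update x i true) - f (update x i false)

lemma dependsOn_cubeDeriv (f : (ι → Bool) → ℝ) (i : ι) : DependsOn (cubeDeriv f i) {i}ᶜ :=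
  fun _ _ h => congrArg₂ (· - ·) (dependsOn_update f i true h) (dependsOn_update f i false h)

lemma cubeDeriv_comp_compl (f : (ι → Bool) → ℝ) (i : ι) (x : ι → Bool) :
    cubeDeriv (fun y => f yᶜ) i x = -cubeDeriv f i xᶜ := by
  have hcompl (b : Bool) : (update x i b)ᶜ = update xᶜ i !b := by
    ext j
    rcases eq_or_ne j i with rfl | hj <;> simp [*]
  simp [cubeDeriv, hcompl]

lemma antitone_cubeDeriv_comp_compl {f : (ι → Bool) → ℝ} {i : ι} (hf : Antitone (cubeDeriv f i)) :
    Antitone (cubeDeriv (fun x => f xᶜ) i) := fun x y h => by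
  simpa only [cubeDeriv_comp_compl, neg_le_neg_iff] using hf (compl_le_compl h)

lemma CubeSubmodular.antitone_cubeDeriv {n : ℕ} {f : Cube n → ℝ} (hf : CubeSubmodular f)
    (i : Fin n) : Antitone (cubeDeriv f i) := by
  intro x y hxy
  have hsup : update x i true ⊔ update y i false = update y i true := by
    ext j
    rcases eq_or_ne j i with rfl | hj <;> simp [*, sup_of_le_right (hxy _)]
  have hinf : update x i true ⊓ update y i false = update x i false := by
    ext j
    rcases eq_or_ne j i with rfl | hj <;> simp [*, inf_of_le_left (hxy _)]
  have h := hf (update x i true) (update y i false)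
  rw [hsup, hinf] at h
  unfold cubeDeriv
  linarith

lemma sum_cubeDeriv_le {f : (ι → Bool) → ℝ} (hf : ∀ i, Antitone (cubeDeriv f i)) {T : Finset ι}
    {x : ι → Bool} (hx : ∀ i ∈ T, x i) :
    ∑ i ∈ T, cubeDeriv f i x ≤ f x - f (T.piecewise ⊥ x) := by
  induction T using Finset.induction_on with
  | empty => simp
  | insert i T hi ih =>
    have hle : T.piecewise ⊥ x ≤ x := piecewise_le_of_le_of_le T bot_le le_rfl
    have htrue : update (T.piecewise ⊥ x) i true = T.piecewise ⊥ x := by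
      rw [update_eq_self_iff, piecewise_eq_of_notMem _ _ _ hi, hx i (mem_insert_self i T)]
    have hderiv : cubeDeriv f i (T.piecewise ⊥ x)
        = f (T.piecewise ⊥ x) - f ((insert i T).piecewise ⊥ x) := by
      rw [cubeDeriv, htrue, piecewise_insert, Pi.bot_apply, bot_eq_false]
    rw [sum_insert hi]
    linarith [hf i hle, ih fun j hj => hx j (mem_insert_of_mem hj)]

lemma sum_posPart_cubeDeriv_le {f : (ι → Bool) → ℝ} (hf : ∀ i, Antitone (cubeDeriv f i))
    (hosc : ∀ x y, f x - f y ≤ 1) (I : Finset ι) (x : ι → Bool) :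
    ∑ i ∈ I with x i, (cubeDeriv f i x)⁺ ≤ 1 := by
  have hpos (t : ℝ) : t⁺ = if 0 < t then t else 0 := by
    split_ifs with ht
    · exact posPart_of_nonneg ht.le
    · exact posPart_of_nonpos (not_lt.1 ht)
  simp only [hpos, ← sum_filter]
  refine (sum_cubeDeriv_le hf fun i hi => ?_).trans (hosc _ _)
  exact (mem_filter.1 (mem_filter.1 hi).1).2

variable [Fintype ι]

lemma mul_sum_bernoulliExpect_posPart_le {f : (ι → Bool) → ℝ}
    (hf : ∀ i, Antitone (cubeDeriv f i)) (hosc : ∀ x y, f x - f y ≤ 1) {p : ℝ}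
    (hp : p ∈ Set.Icc 0 1) (I : Finset ι) :
    p * ∑ i ∈ I, bernoulliExpect p (fun x => (cubeDeriv f i x)⁺) ≤ 1 := by
  have hcoord (i : ι) : p * bernoulliExpect p (fun x => (cubeDeriv f i x)⁺)
      = bernoulliExpect p fun x => if x i then (cubeDeriv f i x)⁺ else 0 := by
    have hdep : DependsOn (fun x => (cubeDeriv f i x)⁺) {i}ᶜ := fun x y h =>
      congrArg _ (dependsOn_cubeDeriv f i h)
    have h := bernoulliExpect_coord_mul p (fun b => if b then 1 else 0) hdep
    simpa using h.symm
  have h := bernoulliExpect_mono hp fun x => sum_posPart_cubeDeriv_le hf hosc I x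
  simp only [sum_filter, bernoulliExpect_const, bernoulliExpect_sum] at h
  simpa only [mul_sum, hcoord] using h

lemma mul_sum_bernoulliExpect_negPart_le {f : (ι → Bool) → ℝ}
    (hf : ∀ i, Antitone (cubeDeriv f i)) (hosc : ∀ x y, f x - f y ≤ 1) {p : ℝ}
    (hp : p ∈ Set.Icc 0 1) (I : Finset ι) :
    (1 - p) * ∑ i ∈ I, bernoulliExpect p (fun x => (cubeDeriv f i x)⁻) ≤ 1 := by
  have h := mul_sum_bernoulliExpect_posPart_le
    (fun i => antitone_cubeDeriv_comp_compl (hf i)) (fun x y => hosc xᶜ yᶜ)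
    (Set.Icc.one_sub_mem hp) I
  have hcompl (i : ι) : bernoulliExpect (1 - p) (fun x => (cubeDeriv f i xᶜ)⁻)
      = bernoulliExpect p fun x => (cubeDeriv f i x)⁻ := by
    rw [bernoulliExpect_compl _ fun x => (cubeDeriv f i x)⁻, sub_sub_cancel]
  simpa only [cubeDeriv_comp_compl, posPart_neg, hcompl] using h

end DiscreteDerivative

section LargeDerivatives

/-- The part of `t` exceeding the threshold `a`: it equals `t` if `a < t` and vanishes otherwise. -/
noncomputable def largePart (a t : ℝ) : ℝ := if a < t then t else 0

lemma largePart_nonneg {a : ℝ} (ha : 0 ≤ a) (t : ℝ) : 0 ≤ largePart a t := by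
  unfold largePart
  split_ifs with h
  exacts [ha.trans h.le, le_rfl]

lemma largePart_le_posPart (a t : ℝ) : largePart a t ≤ t⁺ := by
  unfold largePart
  split_ifs
  exacts [le_posPart t, posPart_nonneg t]

lemma monotone_largePart {a : ℝ} (ha : 0 ≤ a) : Monotone (largePart a) := by
  intro s t hst
  by_cases hs : a < s
  · simpa [largePart, hs, hs.trans_le hst] using hst
  · simpa [largePart, hs] using largePart_nonneg ha t

lemma largePart_zero (t : ℝ) : largePart 0 t = t⁺ := by
  unfold largePart
  split_ifs with ht
  exacts [(posPart_of_nonneg ht.le).symm, (posPart_of_nonpos (not_lt.1 ht)).symm]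

variable {ι : Type*} [DecidableEq ι] [Fintype ι] {f : (ι → Bool) → ℝ}

lemma expect_sq_sum_largePart_le (hf : ∀ i, Antitone (cubeDeriv f i))
    (hosc : ∀ x y, f x - f y ≤ 1) {a : ℝ} (ha : 0 ≤ a) (I : Finset ι) :
    𝔼 x, (∑ i ∈ I, largePart a (cubeDeriv f i x)) ^ 2
      ≤ 4 * bernoulliExpect (1 / 4) fun x => ∑ i ∈ I, largePart a (cubeDeriv f i x) :=
  expect_sq_sum_le_bernoulliExpect
    (fun _ _ _ => largePart_nonneg ha _)
    (fun i _ _ _ h => monotone_largePart ha (hf i h))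
    (fun i _ _ _ h => congrArg _ (dependsOn_cubeDeriv f i h))
    (fun x => (sum_le_sum fun _ _ => largePart_le_posPart a _).trans
      (sum_posPart_cubeDeriv_le hf hosc I x))

/-- The probability that the derivative of `f` in the direction `i` exceeds `a` at a random point
whose coordinates are independent and equal to `true` with probability `p`. -/
noncomputable def derivTail (f : (ι → Bool) → ℝ) (a : ℝ) (i : ι) (p : ℝ) : ℝ :=
  bernoulliExpect p fun x => if a < cubeDeriv f i x then 1 else 0

lemma derivTail_nonneg (f : (ι → Bool) → ℝ) (a : ℝ) (i : ι) {p : ℝ} (hp : p ∈ Set.Icc 0 1) :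
    0 ≤ derivTail f a i p :=
  bernoulliExpect_nonneg hp fun x => by positivity

lemma derivTail_le_pow {i : ι} (hf : Antitone (cubeDeriv f i)) (a : ℝ) {p : ℝ}
    (hp : p ∈ Set.Icc 0 1) (k : ℕ) :
    derivTail f a i (1 - (1 - p) ^ k) ≤ derivTail f a i p ^ k := by
  refine bernoulliExpect_le_pow (fun x => by positivity) (fun x => ?_) (fun x y => ?_) hp k
  · dsimp only [Pi.one_apply]
    split_ifs <;> norm_num
  · by_cases h : a < cubeDeriv f i (x ⊔ y)
    · simp [h, h.trans_le (hf le_sup_left), h.trans_le (hf le_sup_right)]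
    · rw [if_neg h]
      positivity

lemma sum_derivTail_le (hf : ∀ i, Antitone (cubeDeriv f i)) (hosc : ∀ x y, f x - f y ≤ 1) {a p : ℝ}
    (ha : 0 < a) (hp0 : 0 < p) (hp1 : p ≤ 1) (I : Finset ι) :
    ∑ i ∈ I, derivTail f a i p ≤ p⁻¹ / a := by
  have hp : p ∈ Set.Icc 0 1 := ⟨hp0.le, hp1⟩
  have hmarkov (t : ℝ) : a * (if a < t then 1 else 0) ≤ t⁺ := by
    split_ifs with h
    · simpa using h.le.trans (le_posPart t)
    · simp
  rw [le_div_iff₀' ha, ← one_div, le_div_iff₀' hp0]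
  refine le_trans (mul_le_mul_of_nonneg_left ?_ hp.1)
    (mul_sum_bernoulliExpect_posPart_le hf hosc hp I)
  rw [mul_sum]
  refine sum_le_sum fun i _ => ?_
  rw [derivTail, ← bernoulliExpect_const_mul]
  exact bernoulliExpect_mono hp fun x => hmarkov _

lemma bernoulliExpect_sum_largePart_le (hosc : ∀ x y, f x - f y ≤ 1) (a : ℝ) {p : ℝ}
    (hp : p ∈ Set.Icc 0 1) (I : Finset ι) :
    bernoulliExpect p (fun x => ∑ i ∈ I, largePart a (cubeDeriv f i x))
      ≤ ∑ i ∈ I, derivTail f a i p := by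
  rw [bernoulliExpect_sum]
  refine sum_le_sum fun i _ => bernoulliExpect_mono hp fun x => ?_
  unfold largePart
  split_ifs
  exacts [hosc _ _, le_rfl]

lemma exists_one_sub_one_sub_pow_eq {k : ℕ} (hk : k ≠ 0) :
    ∃ p : ℝ, 0 < p ∧ p ≤ 1 ∧ p⁻¹ ≤ 4 * k ∧ 1 - (1 - p) ^ k = 1 / 4 := by
  set r : ℝ := (3 / 4) ^ (k⁻¹ : ℝ)
  have hr0 : 0 ≤ r := by positivity
  have hrk : r ^ k = 3 / 4 := Real.rpow_inv_natCast_pow (by norm_num) hk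
  have hbernoulli := one_add_mul_le_pow (a := r - 1) (by linarith) k
  rw [add_sub_cancel, hrk] at hbernoulli
  have hr1 : 0 < 1 - r := by nlinarith [k.cast_nonneg (α := ℝ)]
  refine ⟨1 - r, hr1, by linarith, (inv_le_iff_one_le_mul₀ hr1).2 (by linarith), ?_⟩
  rw [sub_sub_cancel, hrk]
  norm_num

lemma card_filter_lt_derivTail_le (hf : ∀ i, Antitone (cubeDeriv f i))
    (hosc : ∀ x y, f x - f y ≤ 1) {a p : ℝ} (ha : 0 < a) (hp0 : 0 < p) (hp1 : p ≤ 1) :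
    (#{i | 1 / 4 < derivTail f a i p} : ℝ) ≤ 4 * p⁻¹ / a := by
  set J : Finset ι := {i | 1 / 4 < derivTail f a i p}
  have hJ : (#J : ℝ) * (1 / 4) ≤ ∑ i ∈ J, derivTail f a i p := by
    simpa using card_nsmul_le_sum J _ (1 / 4) fun i hi => (mem_filter.1 hi).2.le
  have hsum := sum_derivTail_le hf hosc ha hp0 hp1 J
  rw [mul_div_assoc]
  linarith

lemma expect_sq_sum_largePart_le_of_derivTail_le (hf : ∀ i, Antitone (cubeDeriv f i))
    (hosc : ∀ x y, f x - f y ≤ 1) {a p : ℝ} {k : ℕ} (ha : 0 < a) (hak : 64 ≤ a ^ 2 * 2 ^ k)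
    (hp0 : 0 < p) (hp1 : p ≤ 1) (hpk : 1 - (1 - p) ^ k = 1 / 4) (hpk' : p⁻¹ ≤ 4 * k)
    {I : Finset ι} (hI : ∀ i ∈ I, derivTail f a i p ≤ 1 / 4) :
    𝔼 x, (∑ i ∈ I, largePart a (cubeDeriv f i x)) ^ 2 ≤ a := by
  have hp : p ∈ Set.Icc 0 1 := ⟨hp0.le, hp1⟩
  have hk : k ≠ 0 := by
    rintro rfl
    norm_num at hpk
  have htail (i : ι) (hi : i ∈ I) :
      derivTail f a i (1 / 4) ≤ (1 / 4) ^ (k - 1) * derivTail f a i p := by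
    have hpow := derivTail_le_pow (hf i) a hp k
    rw [hpk, ← pow_sub_one_mul hk] at hpow
    have hnonneg := derivTail_nonneg f a i hp
    exact hpow.trans (by gcongr; exact hI i hi)
  have hk2 : (k : ℝ) ≤ 2 ^ k := by exact_mod_cast Nat.lt_two_pow_self.le
  have h4 : (4 : ℝ) ^ k = 2 ^ k * 2 ^ k := by
    rw [← mul_pow]
    norm_num
  calc 𝔼 x, (∑ i ∈ I, largePart a (cubeDeriv f i x)) ^ 2
      ≤ 4 * ∑ i ∈ I, derivTail f a i (1 / 4) :=
        (expect_sq_sum_largePart_le hf hosc ha.le I).trans <| by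
          gcongr
          exact bernoulliExpect_sum_largePart_le hosc a (by norm_num) I
    _ ≤ 4 * ((1 / 4) ^ (k - 1) * ∑ i ∈ I, derivTail f a i p) := by
        rw [mul_sum I _ ((1 / 4) ^ (k - 1))]
        gcongr with i hi
        exact htail i hi
    _ ≤ 4 * ((1 / 4) ^ (k - 1) * (4 * k / a)) := by
        gcongr
        exact (sum_derivTail_le hf hosc ha hp0 hp1 I).trans (by gcongr)
    _ = 64 * k / (4 ^ k * a) := by
        rw [← pow_sub_one_mul hk 4]
        simp only [one_div, inv_pow]
        field_simp
        norm_num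
    _ ≤ 64 * 2 ^ k / (4 ^ k * a) := by gcongr
    _ ≤ a := by
        rw [h4, div_le_iff₀ (by positivity)]
        nlinarith [pow_pos (two_pos (α := ℝ)) k]

lemma exists_finset_expect_sq_sum_largePart_le (hf : ∀ i, Antitone (cubeDeriv f i))
    (hosc : ∀ x y, f x - f y ≤ 1) {a : ℝ} {k : ℕ} (ha : 0 < a) (hk : k ≠ 0)
    (hak : 64 ≤ a ^ 2 * 2 ^ k) :
    ∃ J : Finset ι, (#J : ℝ) ≤ 16 * k / a ∧
      ∀ I, Disjoint I J → 𝔼 x, (∑ i ∈ I, largePart a (cubeDeriv f i x)) ^ 2 ≤ a := by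
  obtain ⟨p, hp0, hp1, hpk', hpk⟩ := exists_one_sub_one_sub_pow_eq hk
  refine ⟨({i | 1 / 4 < derivTail f a i p} : Finset ι), ?_, fun I hI => ?_⟩
  · exact (card_filter_lt_derivTail_le hf hosc ha hp0 hp1).trans
      (div_le_div_of_nonneg_right (by linarith) ha.le)
  · refine expect_sq_sum_largePart_le_of_derivTail_le hf hosc ha hak hp0 hp1 hpk hpk' fun i hi => ?_
    simpa using disjoint_left.1 hI hi

end LargeDerivatives

section SignedThreeHalves

/-- The odd extension to the real line of the function `t ↦ t ^ (3 / 2)`. -/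
noncomputable def signedThreeHalves (t : ℝ) : ℝ := t * √|t|

lemma signedThreeHalves_neg (t : ℝ) : signedThreeHalves (-t) = -signedThreeHalves t := by
  simp [signedThreeHalves]

lemma monotone_signedThreeHalves : Monotone signedThreeHalves := by
  intro s t hst
  unfold signedThreeHalves
  rcases le_total 0 s with hs | hs
  · have ht := hs.trans hst
    rw [abs_of_nonneg hs, abs_of_nonneg ht]
    gcongr
  · rcases le_total 0 t with ht | ht
    · exact (mul_nonpos_of_nonpos_of_nonneg hs (Real.sqrt_nonneg _)).trans (by positivity)
    · rw [abs_of_nonpos hs, abs_of_nonpos ht]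
      nlinarith [Real.sqrt_le_sqrt (neg_le_neg hst), Real.sqrt_nonneg (-t), Real.sqrt_nonneg (-s)]

lemma sqrt_mul_signedThreeHalves {h : ℝ} (hh : 0 ≤ h) : √h * signedThreeHalves h = h ^ 2 := by
  rw [signedThreeHalves, abs_of_nonneg hh, mul_left_comm, Real.mul_self_sqrt hh, sq]

lemma add_signedThreeHalves_le {s t : ℝ} (hs : 0 ≤ s) (ht : 0 ≤ t) :
    signedThreeHalves s + signedThreeHalves t ≤ signedThreeHalves (s + t) := by
  unfold signedThreeHalves
  rw [abs_of_nonneg hs, abs_of_nonneg ht, abs_of_nonneg (add_nonneg hs ht), add_mul]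
  gcongr <;> linarith

lemma signedThreeHalves_nonneg {t : ℝ} (ht : 0 ≤ t) : 0 ≤ signedThreeHalves t :=
  mul_nonneg ht (Real.sqrt_nonneg _)

lemma signedThreeHalves_le_four_mul_half {t : ℝ} (ht : 0 ≤ t) :
    signedThreeHalves t ≤ 4 * signedThreeHalves (t / 2) := by
  have hsqrt : √t ≤ 2 * √(t / 2) := by
    rw [Real.sqrt_le_left (by positivity), mul_pow, Real.sq_sqrt (by positivity)]
    linarith
  unfold signedThreeHalves
  rw [abs_of_nonneg ht, abs_of_nonneg (show 0 ≤ t / 2 by positivity)]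
  linarith [mul_le_mul_of_nonneg_left hsqrt ht]

lemma signedThreeHalves_add_le {u v : ℝ} (huv : 0 ≤ u + v) :
    signedThreeHalves (u + v) ≤ 4 * (signedThreeHalves u + signedThreeHalves v) := by
  wlog hle : v ≤ u generalizing u v
  · simpa only [add_comm] using this (by linarith) (le_of_not_ge hle)
  rcases le_total 0 v with hv | hv
  · have hhalf := monotone_signedThreeHalves (show (u + v) / 2 ≤ u by linarith)
    linarith [signedThreeHalves_le_four_mul_half huv, signedThreeHalves_nonneg hv]
  · have h := add_signedThreeHalves_le huv (neg_nonneg.2 hv)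
    rw [signedThreeHalves_neg, add_neg_cancel_right] at h
    linarith [signedThreeHalves_nonneg huv]

lemma signedThreeHalves_sub_le {a b : ℝ} (hab : a ≤ b) :
    signedThreeHalves (b - a) ≤ 4 * (signedThreeHalves b - signedThreeHalves a) := by
  have h := signedThreeHalves_add_le (u := b) (v := -a) (by linarith)
  rwa [signedThreeHalves_neg, ← sub_eq_add_neg, ← sub_eq_add_neg] at h

lemma abs_signedThreeHalves_le {a t : ℝ} (ha : 0 ≤ a) (ht : |t| ≤ 1) :
    |signedThreeHalves t| ≤ √a * (t⁺ + t⁻) + (largePart a t + largePart a (-t)) := by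
  have hlarge : largePart a |t| ≤ largePart a t + largePart a (-t) := by
    rcases abs_choice t with h | h <;> rw [h]
    · exact le_add_of_nonneg_right (largePart_nonneg ha _)
    · exact le_add_of_nonneg_left (largePart_nonneg ha _)
  rw [posPart_add_negPart, signedThreeHalves, abs_mul, abs_of_nonneg (Real.sqrt_nonneg _)]
  refine le_trans ?_ (add_le_add_right hlarge _)
  by_cases h : a < |t|
  · rw [largePart, if_pos h]
    have hle : |t| * √|t| ≤ |t| := mul_le_of_le_one_right (abs_nonneg t) (Real.sqrt_le_one.2 ht)
    have hnonneg : 0 ≤ √a * |t| := by positivity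
    linarith
  · rw [largePart, if_neg h, add_zero, mul_comm]
    gcongr
    exact not_lt.1 h

variable {ι : Type*} [DecidableEq ι]

/-- The sum over `i ∈ I` of the signed `3 / 2`-th powers of the derivatives of `f` at `x`. -/
noncomputable def derivPowSum (f : (ι → Bool) → ℝ) (I : Finset ι) (x : ι → Bool) : ℝ :=
  ∑ i ∈ I, signedThreeHalves (cubeDeriv f i x)

variable {f : (ι → Bool) → ℝ}

lemma sq_derivPowSum_le (hosc : ∀ x y, f x - f y ≤ 1) {a : ℝ} (ha : 0 ≤ a) (I : Finset ι)
    (x : ι → Bool) :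
    derivPowSum f I x ^ 2
      ≤ 4 * a * ((∑ i ∈ I, (cubeDeriv f i x)⁺) ^ 2 + (∑ i ∈ I, (cubeDeriv f i x)⁻) ^ 2)
        + 4 * ((∑ i ∈ I, largePart a (cubeDeriv f i x)) ^ 2
          + (∑ i ∈ I, largePart a (-cubeDeriv f i x)) ^ 2) := by
  have habs : |derivPowSum f I x|
      ≤ √a * (∑ i ∈ I, (cubeDeriv f i x)⁺ + ∑ i ∈ I, (cubeDeriv f i x)⁻)
        + (∑ i ∈ I, largePart a (cubeDeriv f i x) + ∑ i ∈ I, largePart a (-cubeDeriv f i x)) := by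
    simp only [← sum_add_distrib, mul_sum]
    refine (abs_sum_le_sum_abs _ _).trans (sum_le_sum fun i _ => ?_)
    exact abs_signedThreeHalves_le ha (abs_sub_le_iff.2 ⟨hosc _ _, hosc _ _⟩)
  generalize ∑ i ∈ I, (cubeDeriv f i x)⁺ = p, ∑ i ∈ I, (cubeDeriv f i x)⁻ = q,
    ∑ i ∈ I, largePart a (cubeDeriv f i x) = r,
    ∑ i ∈ I, largePart a (-cubeDeriv f i x) = s at habs ⊢
  calc derivPowSum f I x ^ 2 ≤ (√a * (p + q) + (r + s)) ^ 2 := sq_le_sq' (by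
        linarith [neg_abs_le (derivPowSum f I x)]) ((le_abs_self _).trans habs)
    _ ≤ 2 * (√a * (p + q)) ^ 2 + 2 * (r + s) ^ 2 := by
        linarith [add_sq_le (a := √a * (p + q)) (b := r + s)]
    _ = 2 * a * (p + q) ^ 2 + 2 * (r + s) ^ 2 := by rw [mul_pow, Real.sq_sqrt ha, mul_assoc]
    _ ≤ 2 * a * (2 * (p ^ 2 + q ^ 2)) + 2 * (2 * (r ^ 2 + s ^ 2)) := by
        gcongr <;> exact add_sq_le
    _ = 4 * a * (p ^ 2 + q ^ 2) + 4 * (r ^ 2 + s ^ 2) := by ring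

variable [Fintype ι]

lemma expect_sq_sum_posPart_le (hf : ∀ i, Antitone (cubeDeriv f i)) (hosc : ∀ x y, f x - f y ≤ 1)
    (I : Finset ι) : 𝔼 x, (∑ i ∈ I, (cubeDeriv f i x)⁺) ^ 2 ≤ 16 := by
  have hmoment := expect_sq_sum_largePart_le hf hosc le_rfl I
  have hmean := mul_sum_bernoulliExpect_posPart_le (p := 1 / 4) hf hosc (by norm_num) I
  simp only [largePart_zero, bernoulliExpect_sum] at hmoment
  linarith

lemma expect_sq_sum_negPart_le (hf : ∀ i, Antitone (cubeDeriv f i)) (hosc : ∀ x y, f x - f y ≤ 1)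
    (I : Finset ι) : 𝔼 x, (∑ i ∈ I, (cubeDeriv f i x)⁻) ^ 2 ≤ 16 := by
  have h := expect_sq_sum_posPart_le (fun i => antitone_cubeDeriv_comp_compl (hf i))
    (fun x y => hosc xᶜ yᶜ) I
  simpa only [cubeDeriv_comp_compl, posPart_neg,
    expect_comp_compl fun x => (∑ i ∈ I, (cubeDeriv f i x)⁻) ^ 2] using h

lemma exists_finset_expect_sq_derivPowSum_le (hf : ∀ i, Antitone (cubeDeriv f i))
    (hosc : ∀ x y, f x - f y ≤ 1) {a : ℝ} {k : ℕ} (ha : 0 < a) (hk : k ≠ 0)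
    (hak : 64 ≤ a ^ 2 * 2 ^ k) :
    ∃ J : Finset ι, (#J : ℝ) ≤ 32 * k / a ∧
      𝔼 x, derivPowSum f Jᶜ x ^ 2 ≤ 136 * a := by
  obtain ⟨J₁, hJ₁, hlarge⟩ := exists_finset_expect_sq_sum_largePart_le hf hosc ha hk hak
  obtain ⟨J₂, hJ₂, hlarge_neg⟩ := exists_finset_expect_sq_sum_largePart_le
    (fun i => antitone_cubeDeriv_comp_compl (hf i)) (fun x y => hosc xᶜ yᶜ) ha hk hak
  refine ⟨J₁ ∪ J₂, ?_, ?_⟩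
  · calc (#(J₁ ∪ J₂) : ℝ) ≤ #J₁ + #J₂ := mod_cast card_union_le J₁ J₂
      _ ≤ 16 * k / a + 16 * k / a := add_le_add hJ₁ hJ₂
      _ = 32 * k / a := by ring
  set I := (J₁ ∪ J₂)ᶜ
  have h₁ := hlarge I (disjoint_compl_left.mono_right subset_union_left)
  have h₂ := hlarge_neg I (disjoint_compl_left.mono_right subset_union_right)
  simp only [cubeDeriv_comp_compl,
    expect_comp_compl fun x => (∑ i ∈ I, largePart a (-cubeDeriv f i x)) ^ 2] at h₂
  refine (expect_le_expect fun x _ => sq_derivPowSum_le hosc ha.le I x).trans ?_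
  simp only [expect_add_distrib, ← mul_expect]
  nlinarith [expect_sq_sum_posPart_le hf hosc I, expect_sq_sum_negPart_le hf hosc I]

end SignedThreeHalves

section CoordinateSwap

variable {ι : Type*}

/-- The difference of the `j`-th coordinates of two points of the cube, with `true` and `false`
read as `1` and `0`. -/
def coordDiff (j : ι) (p : (ι → Bool) × (ι → Bool)) : ℝ :=
  (if p.1 j then 1 else 0) - (if p.2 j then 1 else 0)

lemma coordDiff_sq (j : ι) (p : (ι → Bool) × (ι → Bool)) :
    coordDiff j p ^ 2 = if p.1 j = p.2 j then 0 else 1 := by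
  cases hx : p.1 j <;> cases hy : p.2 j <;> simp [coordDiff, hx, hy]

variable [DecidableEq ι]

/-- The pair of points obtained from `p` by exchanging the coordinates with index `j`. -/
def swapCoord (j : ι) (p : (ι → Bool) × (ι → Bool)) : (ι → Bool) × (ι → Bool) :=
  (update p.1 j (p.2 j), update p.2 j (p.1 j))

lemma swapCoord_involutive (j : ι) : Involutive (swapCoord j) := by
  rintro ⟨x, y⟩
  simp [swapCoord]

lemma swapCoord_inf (j : ι) (p : (ι → Bool) × (ι → Bool)) :
    (swapCoord j p).1 ⊓ (swapCoord j p).2 = p.1 ⊓ p.2 := by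
  ext i
  rcases eq_or_ne i j with rfl | hi
  · simp [swapCoord, Bool.and_comm]
  · simp [swapCoord, hi]

lemma swapCoord_sup (j : ι) (p : (ι → Bool) × (ι → Bool)) :
    (swapCoord j p).1 ⊔ (swapCoord j p).2 = p.1 ⊔ p.2 := by
  ext i
  rcases eq_or_ne i j with rfl | hi
  · simp [swapCoord, Bool.or_comm]
  · simp [swapCoord, hi]

lemma coordDiff_swapCoord_self (j : ι) (p : (ι → Bool) × (ι → Bool)) :
    coordDiff j (swapCoord j p) = -coordDiff j p := by
  simp [coordDiff, swapCoord]

lemma coordDiff_swapCoord_of_ne {i j : ι} (h : i ≠ j) (p : (ι → Bool) × (ι → Bool)) :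
    coordDiff i (swapCoord j p) = coordDiff i p := by
  simp [coordDiff, swapCoord, h]

lemma coordDiff_mul_sub_swapCoord (Φ : (ι → Bool) → ℝ) (j : ι) (p : (ι → Bool) × (ι → Bool)) :
    coordDiff j p * (Φ p.1 - Φ (swapCoord j p).1) = coordDiff j p ^ 2 * cubeDeriv Φ j p.1 := by
  have hself : Φ (update p.1 j (p.1 j)) = Φ p.1 := by rw [update_eq_self]
  cases hx : p.1 j <;> cases hy : p.2 j <;> rw [hx] at hself <;>
    simp [coordDiff, swapCoord, cubeDeriv, hx, hy, hself]

variable [Fintype ι]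

lemma expect_swapCoord (j : ι) (g : (ι → Bool) × (ι → Bool) → ℝ) :
    𝔼 p, g (swapCoord j p) = 𝔼 p, g p :=
  Fintype.expect_bijective _ (swapCoord_involutive j).bijective _ _ fun _ => rfl

-- Integration by parts: exchanging the `j`-th coordinates preserves the distribution of `p` and the
-- weight `w`, but negates `coordDiff j`.
lemma two_mul_expect_mul_coordDiff (Φ : (ι → Bool) → ℝ) {j : ι}
    {w : (ι → Bool) × (ι → Bool) → ℝ} (hw : ∀ p, w (swapCoord j p) = w p) :
    2 * 𝔼 p, Φ p.1 * (w p * coordDiff j p)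
      = 𝔼 p, coordDiff j p ^ 2 * (w p * cubeDeriv Φ j p.1) := by
  have hswap := expect_swapCoord j fun p => Φ p.1 * (w p * coordDiff j p)
  simp only [hw, coordDiff_swapCoord_self] at hswap
  calc 2 * 𝔼 p, Φ p.1 * (w p * coordDiff j p)
      = 𝔼 p, Φ p.1 * (w p * coordDiff j p)
          - 𝔼 p, Φ (swapCoord j p).1 * (w p * coordDiff j p) := by
        simp only [mul_neg, expect_neg_distrib] at hswap
        linarith
    _ = 𝔼 p, coordDiff j p ^ 2 * (w p * cubeDeriv Φ j p.1) := by
        rw [← expect_sub_distrib]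
        refine expect_congr rfl fun p _ => ?_
        linear_combination w p * coordDiff_mul_sub_swapCoord Φ j p

lemma expect_prod {α β : Type*} [Fintype α] [Fintype β] (g : α × β → ℝ) :
    𝔼 p, g p = 𝔼 x, 𝔼 y, g (x, y) := by
  rw [← univ_product_univ, expect_product]

lemma expect_coordDiff_sq_mul_coordDiff_sq {i j : ι} (hij : i ≠ j) (x : ι → Bool) :
    𝔼 y, coordDiff i (x, y) ^ 2 * coordDiff j (x, y) ^ 2 = 1 / 4 := by
  have hhalf (k : ι) : ((if x k = true then 0 else 1) + if x k = false then 0 else 1) / 2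
      = (1 / 2 : ℝ) := by
    cases x k <;> simp
  have hj := expect_coord_mul (fun b => if x j = b then 0 else 1) (i := j)
    (g := fun _ => 1) fun _ _ _ => rfl
  have hi := expect_coord_mul (fun b => if x i = b then 0 else 1) (i := i)
    (g := fun y => if x j = y j then 0 else 1) fun y z h => by
      simp only [h j hij.symm]
  simp only [hhalf, mul_one, Fintype.expect_const] at hi hj
  simp only [coordDiff_sq, hi, hj]
  norm_num

end CoordinateSwap

section SecondDerivative

variable {ι : Type*} [DecidableEq ι] {f : (ι → Bool) → ℝ}

/-- The square root of the drop of the derivative of `f` in the direction `j` between the meet and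
the join of two points, used as a weight that is invariant under all `swapCoord`. -/
noncomputable def derivGap (f : (ι → Bool) → ℝ) (j : ι) (p : (ι → Bool) × (ι → Bool)) : ℝ :=
  √(cubeDeriv f j (p.1 ⊓ p.2) - cubeDeriv f j (p.1 ⊔ p.2))

lemma derivGap_swapCoord (f : (ι → Bool) → ℝ) (i j : ι) (p : (ι → Bool) × (ι → Bool)) :
    derivGap f i (swapCoord j p) = derivGap f i p := by
  simp only [derivGap, swapCoord_inf, swapCoord_sup]

lemma cubeDeriv_cubeDeriv_self (f : (ι → Bool) → ℝ) (i : ι) (x : ι → Bool) :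
    cubeDeriv (cubeDeriv f i) i x = 0 := by
  simp [cubeDeriv]

lemma cubeDeriv_cubeDeriv_comm (f : (ι → Bool) → ℝ) (i j : ι) (x : ι → Bool) :
    cubeDeriv (cubeDeriv f i) j x = cubeDeriv (cubeDeriv f j) i x := by
  rcases eq_or_ne i j with rfl | hij
  · rfl
  · simp only [cubeDeriv, update_comm hij]
    ring

lemma cubeDeriv_nonpos {g : (ι → Bool) → ℝ} (hg : Antitone g) (j : ι) (x : ι → Bool) :
    cubeDeriv g j x ≤ 0 :=
  sub_nonpos.2 (hg (update_le_update_iff.2 ⟨Bool.false_le _, fun _ _ => le_rfl⟩))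

lemma sum_signedThreeHalves_le (hf : ∀ i, Antitone (cubeDeriv f i)) (I : Finset ι) (j : ι)
    (x : ι → Bool) :
    ∑ i ∈ I, signedThreeHalves (-cubeDeriv (cubeDeriv f i) j x)
      ≤ -4 * cubeDeriv (derivPowSum f I) j x := by
  rw [cubeDeriv, derivPowSum, derivPowSum, ← sum_sub_distrib, mul_sum]
  refine sum_le_sum fun i _ => ?_
  have h := signedThreeHalves_sub_le (sub_nonpos.1 (cubeDeriv_nonpos (hf i) j x))
  rw [cubeDeriv, neg_sub]
  linarith

lemma sqrt_neg_cubeDeriv_cubeDeriv_le_derivGap (hf : ∀ i, Antitone (cubeDeriv f i)) (i j : ι)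
    {p : (ι → Bool) × (ι → Bool)} (hp : p.1 i ≠ p.2 i) :
    √(-cubeDeriv (cubeDeriv f i) j p.1) ≤ derivGap f j p := by
  have hinf : p.1 ⊓ p.2 ≤ update p.1 i false :=
    le_update_iff.2 ⟨by cases hx : p.1 i <;> cases hy : p.2 i <;> simp_all, fun k _ => inf_le_left⟩
  have hsup : update p.1 i true ≤ p.1 ⊔ p.2 :=
    update_le_iff.2 ⟨by cases hx : p.1 i <;> cases hy : p.2 i <;> simp_all, fun k _ => le_sup_left⟩
  rw [cubeDeriv_cubeDeriv_comm, cubeDeriv, neg_sub]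
  exact Real.sqrt_le_sqrt (sub_le_sub (hf j hinf) (hf j hsup))

lemma coordDiff_sq_mul_sq_le (hf : ∀ i, Antitone (cubeDeriv f i)) (i j : ι)
    (p : (ι → Bool) × (ι → Bool)) :
    coordDiff i p ^ 2 * cubeDeriv (cubeDeriv f i) j p.1 ^ 2
      ≤ derivGap f j p * signedThreeHalves (-cubeDeriv (cubeDeriv f i) j p.1) := by
  have hH := neg_nonneg.2 (cubeDeriv_nonpos (hf i) j p.1)
  have hψ := signedThreeHalves_nonneg hH
  rw [coordDiff_sq]
  split_ifs with hp
  · rw [zero_mul]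
    exact mul_nonneg (Real.sqrt_nonneg _) hψ
  · rw [one_mul, ← neg_sq, ← sqrt_mul_signedThreeHalves hH]
    exact mul_le_mul_of_nonneg_right (sqrt_neg_cubeDeriv_cubeDeriv_le_derivGap hf i j hp) hψ

variable [Fintype ι]

lemma expect_derivGap_sq_le (hf : ∀ i, Antitone (cubeDeriv f i)) (hosc : ∀ x y, f x - f y ≤ 1)
    (I : Finset ι) : ∑ j ∈ I, 𝔼 p, derivGap f j p ^ 2 ≤ 8 := by
  have hgap (j : ι) : 𝔼 p, derivGap f j p ^ 2
      ≤ bernoulliExpect (1 / 4) (fun x => (cubeDeriv f j x)⁺)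
        + bernoulliExpect (3 / 4) (fun x => (cubeDeriv f j x)⁻) := by
    rw [← expect_expect_inf, ← expect_expect_sup, ← expect_add_distrib, expect_prod]
    refine expect_le_expect fun x _ => ?_
    rw [← expect_add_distrib]
    refine expect_le_expect fun y _ => ?_
    rw [derivGap, Real.sq_sqrt (sub_nonneg.2 (hf j inf_le_sup)), sub_eq_add_neg]
    exact add_le_add (le_posPart _) (neg_le_negPart _)
  have hpos := mul_sum_bernoulliExpect_posPart_le (p := 1 / 4) hf hosc (by norm_num) I
  have hneg := mul_sum_bernoulliExpect_negPart_le (p := 3 / 4) hf hosc (by norm_num) I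
  refine (sum_le_sum fun j _ => hgap j).trans ?_
  rw [sum_add_distrib]
  linarith

/-- The sum of the coordinate differences of two points in the directions `j ∈ I`, weighted by the
gaps of the derivatives of `f`; the second derivatives of `f` are recovered by integrating it by
parts. -/
noncomputable def gapSum (f : (ι → Bool) → ℝ) (I : Finset ι) (p : (ι → Bool) × (ι → Bool)) : ℝ :=
  ∑ j ∈ I, derivGap f j p * coordDiff j p

lemma expect_gapSum_sq_le (hf : ∀ i, Antitone (cubeDeriv f i)) (hosc : ∀ x y, f x - f y ≤ 1)
    (I : Finset ι) : 𝔼 p, gapSum f I p ^ 2 ≤ 8 := by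
  have hcross (j k : ι) (hkj : k ≠ j) :
      𝔼 p, derivGap f j p * coordDiff j p * (derivGap f k p * coordDiff k p) = 0 := by
    have h := expect_swapCoord j fun p =>
      derivGap f j p * coordDiff j p * (derivGap f k p * coordDiff k p)
    simp only [derivGap_swapCoord, coordDiff_swapCoord_self, coordDiff_swapCoord_of_ne hkj, mul_neg,
      neg_mul, expect_neg_distrib] at h
    linarith
  calc 𝔼 p, gapSum f I p ^ 2
      = ∑ j ∈ I, ∑ k ∈ I,
          𝔼 p, derivGap f j p * coordDiff j p * (derivGap f k p * coordDiff k p) := by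
        simp only [gapSum, sq, sum_mul_sum, expect_sum_comm]
    _ = ∑ j ∈ I, 𝔼 p, derivGap f j p * coordDiff j p * (derivGap f j p * coordDiff j p) :=
        sum_congr rfl fun j hj => sum_eq_single_of_mem j hj fun k _ hk => hcross j k hk
    _ ≤ ∑ j ∈ I, 𝔼 p, derivGap f j p ^ 2 := by
        gcongr with j _ p
        rw [← sq, mul_pow, coordDiff_sq]
        exact mul_le_of_le_one_right (sq_nonneg _) (by split_ifs <;> norm_num)
    _ ≤ 8 := expect_derivGap_sq_le hf hosc I

lemma sum_expect_coordDiff_sq_mul_sq_le (hf : ∀ i, Antitone (cubeDeriv f i)) (I : Finset ι)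
    (j : ι) :
    ∑ i ∈ I, 𝔼 p, coordDiff j p ^ 2 * (coordDiff i p ^ 2 * cubeDeriv (cubeDeriv f i) j p.1 ^ 2)
      ≤ -8 * 𝔼 p, derivPowSum f I p.1 * (derivGap f j p * coordDiff j p) := by
  have hparts := two_mul_expect_mul_coordDiff (derivPowSum f I) (derivGap_swapCoord f j j)
  rw [← expect_sum_comm]
  calc 𝔼 p, ∑ i ∈ I, coordDiff j p ^ 2 * (coordDiff i p ^ 2 * cubeDeriv (cubeDeriv f i) j p.1 ^ 2)
      ≤ 𝔼 p, coordDiff j p ^ 2 * (derivGap f j p * (-4 * cubeDeriv (derivPowSum f I) j p.1)) := by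
        gcongr with p
        rw [← mul_sum]
        gcongr
        refine (sum_le_sum fun i _ => coordDiff_sq_mul_sq_le hf i j p).trans ?_
        rw [← mul_sum]
        exact mul_le_mul_of_nonneg_left (sum_signedThreeHalves_le hf I j p.1) (Real.sqrt_nonneg _)
    _ = -4 * 𝔼 p, coordDiff j p ^ 2 * (derivGap f j p * cubeDeriv (derivPowSum f I) j p.1) := by
        rw [mul_expect]
        exact expect_congr rfl fun p _ => by ring
    _ = -8 * 𝔼 p, derivPowSum f I p.1 * (derivGap f j p * coordDiff j p) := by
        rw [← hparts]
        ring

lemma expect_coordDiff_sq_mul_cubeDeriv_cubeDeriv_sq (f : (ι → Bool) → ℝ) (i j : ι) :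
    𝔼 p, coordDiff j p ^ 2 * (coordDiff i p ^ 2 * cubeDeriv (cubeDeriv f i) j p.1 ^ 2)
      = 1 / 4 * 𝔼 x, cubeDeriv (cubeDeriv f i) j x ^ 2 := by
  rcases eq_or_ne j i with rfl | hij
  · simp [cubeDeriv_cubeDeriv_self]
  · simp only [expect_prod, ← mul_assoc, ← expect_mul, mul_expect,
      expect_coordDiff_sq_mul_coordDiff_sq hij]

lemma sq_sum_expect_cubeDeriv_cubeDeriv_sq_le (hf : ∀ i, Antitone (cubeDeriv f i))
    (hosc : ∀ x y, f x - f y ≤ 1) (I : Finset ι) :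
    (∑ j ∈ I, ∑ i ∈ I, 𝔼 x, cubeDeriv (cubeDeriv f i) j x ^ 2) ^ 2
      ≤ 8192 * 𝔼 x, derivPowSum f I x ^ 2 := by
  have hparts : ∑ j ∈ I, ∑ i ∈ I, 𝔼 x, cubeDeriv (cubeDeriv f i) j x ^ 2
      ≤ -32 * 𝔼 p, derivPowSum f I p.1 * gapSum f I p := by
    have h := sum_le_sum fun j (_ : j ∈ I) => sum_expect_coordDiff_sq_mul_sq_le hf I j
    simp only [expect_coordDiff_sq_mul_cubeDeriv_cubeDeriv_sq, ← mul_sum, ← expect_sum_comm] at h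
    simp only [gapSum, ← expect_sum_comm]
    linarith
  have hsq : 𝔼 p : (ι → Bool) × (ι → Bool), derivPowSum f I p.1 ^ 2
      = 𝔼 x, derivPowSum f I x ^ 2 := by
    simp only [expect_prod, Fintype.expect_const]
  have hcauchy := expect_mul_sq_le_sq_mul_sq univ
    (fun p : (ι → Bool) × (ι → Bool) => derivPowSum f I p.1) (gapSum f I)
  have hnonneg : 0 ≤ 𝔼 x, derivPowSum f I x ^ 2 := expect_nonneg fun _ _ => sq_nonneg _
  calc (∑ j ∈ I, ∑ i ∈ I, 𝔼 x, cubeDeriv (cubeDeriv f i) j x ^ 2) ^ 2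
      ≤ (-32 * 𝔼 p, derivPowSum f I p.1 * gapSum f I p) ^ 2 :=
        pow_le_pow_left₀ (sum_nonneg fun _ _ => sum_nonneg fun _ _ => expect_nonneg fun _ _ =>
          sq_nonneg _) hparts 2
    _ = 1024 * (𝔼 p, derivPowSum f I p.1 * gapSum f I p) ^ 2 := by ring
    _ ≤ 1024 * ((𝔼 x, derivPowSum f I x ^ 2) * 8) := by
        rw [hsq] at hcauchy
        gcongr
        exact hcauchy.trans (mul_le_mul_of_nonneg_left (expect_gapSum_sq_le hf hosc I) hnonneg)
    _ = 8192 * 𝔼 x, derivPowSum f I x ^ 2 := by ring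

end SecondDerivative

section Walsh

variable {ι : Type*}

/-- The Walsh function with index `S`: the character of the cube, regarded as the group `(ℤ/2)^ι`,
that gives the parity of the number of coordinates in `S` equal to `true`. -/
def walsh (S : Finset ι) (x : ι → Bool) : ℝ := ∏ i ∈ S, if x i then -1 else 1

lemma sum_walsh_mul_walsh_index [Fintype ι] (x y : ι → Bool) :
    ∑ S, walsh S x * walsh S y = if x = y then 2 ^ Fintype.card ι else 0 := by
  classical
  have hfactor (i : ι) : ((if x i then -1 else 1) * if y i then -1 else 1) + 1
      = if x i = y i then (2 : ℝ) else 0 := by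
    cases x i <;> cases y i <;> norm_num
  simp_rw [walsh, ← prod_mul_distrib]
  rw [← powerset_univ, ← prod_add_one, prod_congr rfl fun i _ => hfactor i, prod_ite_zero]
  simp [funext_iff]

variable [DecidableEq ι]

lemma walsh_flipCoord (S : Finset ι) (i : ι) (x : ι → Bool) :
    walsh S (flipCoord i x) = (if i ∈ S then -1 else 1) * walsh S x := by
  have hfactor (j : ι) : (if flipCoord i x j then -1 else 1)
      = (if i = j then -1 else 1) * if x j then (-1 : ℝ) else 1 := by
    rcases eq_or_ne i j with rfl | hj
    · cases hx : x i <;> simp [flipCoord_self, hx]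
    · simp [flipCoord_of_ne hj.symm, hj]
  simp only [walsh, hfactor, prod_mul_distrib, prod_ite_eq]

/-- The change of `f` when the coordinate `i` is flipped. Up to sign it is the discrete derivative,
but unlike the latter it acts diagonally on the Walsh functions. -/
def flipDiff (f : (ι → Bool) → ℝ) (i : ι) (x : ι → Bool) : ℝ := f x - f (flipCoord i x)

lemma flipDiff_eq_ite_mul_cubeDeriv (f : (ι → Bool) → ℝ) (i : ι) (x : ι → Bool) :
    flipDiff f i x = (if x i then 1 else -1) * cubeDeriv f i x := by
  have hself : f (update x i (x i)) = f x := by rw [update_eq_self]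
  cases hx : x i <;> rw [hx] at hself <;> simp [flipDiff, flipCoord, cubeDeriv, hx, hself]

lemma cubeDeriv_cubeDeriv_sq {i j : ι} (hij : i ≠ j) (f : (ι → Bool) → ℝ) (x : ι → Bool) :
    cubeDeriv (cubeDeriv f i) j x ^ 2 = flipDiff (flipDiff f i) j x ^ 2 := by
  have hsign (k : ι) : (if x k then 1 else -1) ^ 2 = (1 : ℝ) := by
    split_ifs <;> norm_num
  have hcomm : cubeDeriv (flipDiff f i) j x
      = (if x i then 1 else -1) * cubeDeriv (cubeDeriv f i) j x := by
    simp only [cubeDeriv.eq_1 (flipDiff f i), cubeDeriv.eq_1 (cubeDeriv f i),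
      flipDiff_eq_ite_mul_cubeDeriv, update_of_ne hij, mul_sub]
  rw [flipDiff_eq_ite_mul_cubeDeriv, hcomm, mul_pow, mul_pow, hsign, hsign, one_mul, one_mul]

variable [Fintype ι]

lemma expect_walsh_mul_walsh (S T : Finset ι) :
    𝔼 x, walsh S x * walsh T x = if S = T then 1 else 0 := by
  have hwalsh (S : Finset ι) (x : ι → Bool) :
      walsh S x = ∏ i, if i ∈ S ∧ x i then (-1 : ℝ) else 1 := by
    simp [walsh, ite_and, prod_ite_mem]
  let c (i : ι) (b : Bool) : ℝ := (if i ∈ S ∧ b then -1 else 1) * if i ∈ T ∧ b then -1 else 1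
  have hc (i : ι) : c i true + c i false = if i ∈ S ↔ i ∈ T then 2 else 0 := by
    by_cases hS : i ∈ S <;> by_cases hT : i ∈ T <;> norm_num [c, hS, hT]
  have hsum : ∑ x : ι → Bool, walsh S x * walsh T x = if S = T then 2 ^ Fintype.card ι else 0 := by
    simp_rw [hwalsh, ← prod_mul_distrib]
    rw [sum_prod_coord c]
    simp only [hc, prod_ite_zero]
    simp [Finset.ext_iff]
  rw [Fintype.expect_eq_sum_div_card, hsum]
  simp [ite_div]

/-- The coefficient of the Walsh function with index `S` in the expansion of `f`. -/
noncomputable def walshCoeff (f : (ι → Bool) → ℝ) (S : Finset ι) : ℝ := 𝔼 x, f x * walsh S x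

lemma sum_walshCoeff_mul_walsh (f : (ι → Bool) → ℝ) (x : ι → Bool) :
    ∑ S, walshCoeff f S * walsh S x = f x := by
  simp_rw [walshCoeff, expect_mul, mul_assoc, ← expect_sum_comm, ← mul_sum,
    sum_walsh_mul_walsh_index, Fintype.expect_eq_sum_div_card]
  simp

lemma expect_sq_sum_mul_walsh (𝒮 : Finset (Finset ι)) (c : Finset ι → ℝ) :
    𝔼 x, (∑ S ∈ 𝒮, c S * walsh S x) ^ 2 = ∑ S ∈ 𝒮, c S ^ 2 := by
  simp_rw [sq, sum_mul_sum, expect_sum_comm, mul_mul_mul_comm, ← mul_expect, expect_walsh_mul_walsh]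
  simp +contextual

lemma expect_sq_eq_sum_walshCoeff_sq (f : (ι → Bool) → ℝ) :
    𝔼 x, f x ^ 2 = ∑ S, walshCoeff f S ^ 2 := by
  simp only [← expect_sq_sum_mul_walsh, sum_walshCoeff_mul_walsh]

lemma walshCoeff_flipDiff (f : (ι → Bool) → ℝ) (i : ι) (S : Finset ι) :
    walshCoeff (flipDiff f i) S = (if i ∈ S then 2 else 0) * walshCoeff f S := by
  have hflip : 𝔼 x, f (flipCoord i x) * walsh S x
      = (if i ∈ S then -1 else 1) * 𝔼 x, f x * walsh S x := by
    rw [mul_expect]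
    refine Fintype.expect_bijective _ (flipCoord_involutive i).bijective _ _ fun x => ?_
    rw [walsh_flipCoord]
    split_ifs <;> ring
  simp only [walshCoeff, flipDiff, sub_mul, expect_sub_distrib, hflip]
  split_ifs <;> ring

lemma expect_cubeDeriv_cubeDeriv_sq (f : (ι → Bool) → ℝ) (i j : ι) :
    𝔼 x, cubeDeriv (cubeDeriv f i) j x ^ 2
      = ∑ S : Finset ι, if (i, j) ∈ S.offDiag then 16 * walshCoeff f S ^ 2 else 0 := by
  rcases eq_or_ne i j with rfl | hij
  · simp [cubeDeriv_cubeDeriv_self]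
  · simp only [cubeDeriv_cubeDeriv_sq hij, expect_sq_eq_sum_walshCoeff_sq, walshCoeff_flipDiff]
    refine sum_congr rfl fun S _ => ?_
    by_cases hi : i ∈ S <;> by_cases hj : j ∈ S <;> simp [hi, hj, hij]
    ring

lemma sum_expect_cubeDeriv_cubeDeriv_sq (f : (ι → Bool) → ℝ) (I : Finset ι) :
    ∑ j ∈ I, ∑ i ∈ I, 𝔼 x, cubeDeriv (cubeDeriv f i) j x ^ 2
      = ∑ S, #(I ∩ S).offDiag * (16 * walshCoeff f S ^ 2) := by
  simp only [expect_cubeDeriv_cubeDeriv_sq]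
  rw [sum_comm, ← sum_product', sum_comm]
  refine sum_congr rfl fun S _ => ?_
  have hoffDiag : {p ∈ I ×ˢ I | (p.1, p.2) ∈ S.offDiag} = (I ∩ S).offDiag := by
    ext p
    simp only [mem_filter, mem_product, mem_offDiag, mem_inter]
    tauto
  rw [← sum_filter, hoffDiag, sum_const, nsmul_eq_mul]

lemma sum_walshCoeff_sq_le (f : (ι → Bool) → ℝ) (I : Finset ι) (d : ℕ) :
    16 * d ^ 2 * ∑ S with d < #(I ∩ S), walshCoeff f S ^ 2
      ≤ ∑ j ∈ I, ∑ i ∈ I, 𝔼 x, cubeDeriv (cubeDeriv f i) j x ^ 2 := by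
  rw [sum_expect_cubeDeriv_cubeDeriv_sq, mul_sum]
  refine (sum_le_sum fun S hS => ?_).trans
    (sum_le_univ_sum_of_nonneg (fun _ => by positivity))
  have hcard : d ^ 2 ≤ #(I ∩ S).offDiag := by
    rw [offDiag_card, ← Nat.mul_sub_one, sq]
    have hd := (mem_filter.1 hS).2
    exact Nat.mul_le_mul hd.le (Nat.le_sub_one_of_lt hd)
  calc 16 * (d : ℝ) ^ 2 * walshCoeff f S ^ 2 = d ^ 2 * (16 * walshCoeff f S ^ 2) := by ring
    _ ≤ #(I ∩ S).offDiag * (16 * walshCoeff f S ^ 2) := by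
        gcongr
        exact_mod_cast hcard

end Walsh

section LowDegree

variable {n : ℕ}

lemma cubeL2Norm_sq (g : Cube n → ℝ) : cubeL2Norm g ^ 2 = 𝔼 x, g x ^ 2 := by
  rw [cubeL2Norm, Real.sq_sqrt (by positivity), Fintype.expect_eq_sum_div_card]
  simp

/-- The multilinear polynomial that agrees with the Walsh function with index `S` on the cube. -/
noncomputable def walshPoly (S : Finset (Fin n)) : MvPolynomial (Fin n) ℝ :=
  ∏ i ∈ S, (1 - MvPolynomial.C 2 * MvPolynomial.X i)

lemma polyOnCube_walshPoly (S : Finset (Fin n)) (x : Cube n) :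
    polyOnCube (walshPoly S) x = walsh S x := by
  rw [polyOnCube, walshPoly, map_prod, walsh]
  refine prod_congr rfl fun i _ => ?_
  cases hx : x i <;> norm_num [hx]

lemma totalDegree_walshPoly_le (S : Finset (Fin n)) : (walshPoly S).totalDegree ≤ #S := by
  have hfactor (i : Fin n) :
      (1 - MvPolynomial.C 2 * MvPolynomial.X i : MvPolynomial (Fin n) ℝ).totalDegree ≤ 1 := by
    refine (MvPolynomial.totalDegree_sub _ _).trans (max_le (by simp) ?_)
    exact (MvPolynomial.totalDegree_mul _ _).trans (by simp)
  refine (MvPolynomial.totalDegree_finsetProd _ _).trans ?_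
  rw [card_eq_sum_ones]
  exact sum_le_sum fun i _ => hfactor i

lemma exists_totalDegree_le_cubeL2Norm_sub_sq_eq (f : Cube n → ℝ) {𝒮 : Finset (Finset (Fin n))}
    {m : ℕ} (h𝒮 : ∀ S ∈ 𝒮, #S ≤ m) :
    ∃ p : MvPolynomial (Fin n) ℝ, p.totalDegree ≤ m ∧
      cubeL2Norm (fun x => f x - polyOnCube p x) ^ 2 = ∑ S ∈ 𝒮ᶜ, walshCoeff f S ^ 2 := by
  refine ⟨∑ S ∈ 𝒮, MvPolynomial.C (walshCoeff f S) * walshPoly S, ?_, ?_⟩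
  · refine MvPolynomial.totalDegree_finsetSum_le fun S hS => ?_
    refine (MvPolynomial.totalDegree_mul _ _).trans ?_
    rw [MvPolynomial.totalDegree_C, zero_add]
    exact (totalDegree_walshPoly_le S).trans (h𝒮 S hS)
  · rw [cubeL2Norm_sq, ← expect_sq_sum_mul_walsh]
    refine expect_congr rfl fun x _ => ?_
    rw [← sum_walshCoeff_mul_walsh f x, ← sum_add_sum_compl 𝒮]
    simp [polyOnCube, ← polyOnCube_walshPoly]

lemma exists_totalDegree_le_mul_cubeL2Norm_sub_sq_le (f : Cube n → ℝ) (J : Finset (Fin n)) (d : ℕ) :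
    ∃ p : MvPolynomial (Fin n) ℝ, p.totalDegree ≤ #J + d ∧
      16 * d ^ 2 * cubeL2Norm (fun x => f x - polyOnCube p x) ^ 2
        ≤ ∑ j ∈ Jᶜ, ∑ i ∈ Jᶜ, 𝔼 x, cubeDeriv (cubeDeriv f i) j x ^ 2 := by
  have hcard (S : Finset (Fin n)) (hS : S ∈ ({S | d < #(Jᶜ ∩ S)} : Finset _)ᶜ) : #S ≤ #J + d := by
    have hd : #(S ∩ Jᶜ) ≤ d := by simpa [inter_comm] using hS
    calc #S ≤ #(J ∪ S ∩ Jᶜ) := card_le_card fun i hi => by by_cases i ∈ J <;> simp_all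
      _ ≤ #J + d := (card_union_le _ _).trans (by lia)
  obtain ⟨p, hdeg, hp⟩ := exists_totalDegree_le_cubeL2Norm_sub_sq_eq f hcard
  rw [compl_compl] at hp
  exact ⟨p, hdeg, hp ▸ sum_walshCoeff_sq_le f Jᶜ d⟩

end LowDegree

section Parameters

variable {n : ℕ}

lemma cubeL2Norm_le_of_abs_le {g : Cube n → ℝ} {c : ℝ} (h : ∀ x, |g x| ≤ c) :
    cubeL2Norm g ≤ c := by
  have hc : 0 ≤ c := (abs_nonneg _).trans (h ⊥)
  refine le_of_pow_le_pow_left₀ two_ne_zero hc ?_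
  rw [cubeL2Norm_sq, ← Fintype.expect_const (ι := Cube n) (c ^ 2)]
  exact expect_le_expect fun x _ => sq_le_sq.2 ((h x).trans (le_abs_self c))

lemma exists_totalDegree_le_cubeL2Norm_sub_pow_le {f : Cube n → ℝ} (hf : CubeSubmodular f)
    (hosc : ∀ x y, f x - f y ≤ 1) {a : ℝ} {k : ℕ} (ha : 0 < a) (hk : k ≠ 0)
    (hak : 64 ≤ a ^ 2 * 2 ^ k) :
    ∃ p : MvPolynomial (Fin n) ℝ, (p.totalDegree : ℝ) ≤ (32 * k + 9) / a + 1 ∧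
      cubeL2Norm (fun x => f x - polyOnCube p x) ^ 4 ≤ a ^ 5 := by
  obtain ⟨J, hJ, hsmall⟩ :=
    exists_finset_expect_sq_derivPowSum_le hf.antitone_cubeDeriv hosc ha hk hak
  obtain ⟨p, hdeg, hp⟩ := exists_totalDegree_le_mul_cubeL2Norm_sub_sq_le f J ⌈9 / a⌉₊
  have henergy := sq_sum_expect_cubeDeriv_cubeDeriv_sq_le hf.antitone_cubeDeriv hosc Jᶜ
  set N := cubeL2Norm fun x => f x - polyOnCube p x
  have hceil : 9 / a ≤ ⌈9 / a⌉₊ := Nat.le_ceil _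
  have hceil_lt := Nat.ceil_lt_add_one (show 0 ≤ 9 / a by positivity)
  refine ⟨p, ?_, ?_⟩
  · calc (p.totalDegree : ℝ) ≤ #J + ⌈9 / a⌉₊ := mod_cast hdeg
      _ ≤ 32 * k / a + (9 / a + 1) := add_le_add hJ hceil_lt.le
      _ = (32 * k + 9) / a + 1 := by ring
  · have hbound : (16 * (9 / a) ^ 2 * N ^ 2) ^ 2 ≤ 8192 * (136 * a) :=
      calc (16 * (9 / a) ^ 2 * N ^ 2) ^ 2 ≤ (16 * ⌈9 / a⌉₊ ^ 2 * N ^ 2) ^ 2 := by gcongr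
        _ ≤ (∑ j ∈ Jᶜ, ∑ i ∈ Jᶜ, 𝔼 x, cubeDeriv (cubeDeriv f i) j x ^ 2) ^ 2 := by gcongr
        _ ≤ 8192 * (136 * a) := henergy.trans (by gcongr)
    calc N ^ 4 = (16 * (9 / a) ^ 2 * N ^ 2) ^ 2 * (a ^ 4 / (16 * 81) ^ 2) := by
          field_simp
          norm_num
      _ ≤ 8192 * (136 * a) * (a ^ 4 / (16 * 81) ^ 2) := by gcongr
      _ ≤ a ^ 5 := by linarith [pow_pos ha 5]

lemma half_le_log_one_div {ε : ℝ} (h0 : 0 < ε) (h1 : ε ≤ 1 / 2) : 1 / 2 ≤ Real.log (1 / ε) := by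
  have hlog : Real.log 2 ≤ Real.log (1 / ε) :=
    Real.log_le_log two_pos ((le_one_div two_pos h0).2 h1)
  linarith [Real.log_two_gt_d9]

lemma exists_le_mul_log_sixtyFour_le {ε : ℝ} (h0 : 0 < ε) (h1 : ε ≤ 1 / 2) :
    ∃ k : ℕ, k ≠ 0 ∧ k ≤ 14 * Real.log (1 / ε) ∧ 64 ≤ ε ^ 2 * 2 ^ k := by
  set L := Real.log (1 / ε) with hL
  have hhalf : 1 / 2 ≤ L := half_le_log_one_div h0 h1
  have hceil : 12 * L ≤ ⌈12 * L⌉₊ := Nat.le_ceil _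
  have hceil_lt := Nat.ceil_lt_add_one (show 0 ≤ 12 * L by linarith)
  refine ⟨⌈12 * L⌉₊, (Nat.ceil_pos.2 (by linarith)).ne', by linarith, ?_⟩
  have hpow : (1 / ε) ^ 8 ≤ 2 ^ ⌈12 * L⌉₊ := by
    rw [← Real.log_le_log_iff (by positivity) (by positivity), Real.log_pow, Real.log_pow, ← hL]
    calc (8 : ℕ) * L ≤ 12 * L * 0.69 := by norm_num; linarith
      _ ≤ ⌈12 * L⌉₊ * Real.log 2 := by
          gcongr
          linarith [Real.log_two_gt_d9]
  calc (64 : ℝ) = 2 ^ 6 := by norm_num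
    _ ≤ (1 / ε) ^ 6 := by
        gcongr
        exact (le_one_div two_pos h0).2 h1
    _ = ε ^ 2 * (1 / ε) ^ 8 := by field_simp
    _ ≤ ε ^ 2 * 2 ^ ⌈12 * L⌉₊ := by gcongr

lemma exists_totalDegree_le_log_cubeL2Norm_sub_le {f : Cube n → ℝ} (hf : CubeSubmodular f)
    (hosc : ∀ x y, f x - f y ≤ 1) {ε : ℝ} (h0 : 0 < ε) (h1 : ε ≤ 1 / 2) :
    ∃ p : MvPolynomial (Fin n) ℝ,
      (p.totalDegree : ℝ) ≤ 500 * ε ^ (-(4 / 5) : ℝ) * Real.log (1 / ε) ∧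
        cubeL2Norm (fun x => f x - polyOnCube p x) ≤ ε := by
  obtain ⟨k, hk, hkL, hkε⟩ := exists_le_mul_log_sixtyFour_le h0 h1
  have hL := half_le_log_one_div h0 h1
  set L := Real.log (1 / ε)
  set a := ε ^ (4 / 5 : ℝ) with ha_def
  have ha : 0 < a := by positivity
  have ha1 : a ≤ 1 := Real.rpow_le_one h0.le (by linarith) (by norm_num)
  have hεa : ε ≤ a := Real.self_le_rpow_of_le_one h0.le (by linarith) (by norm_num)
  have hpow : a ^ 5 = ε ^ 4 := by
    rw [ha_def, ← Real.rpow_mul_natCast h0.le, ← Real.rpow_natCast]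
    norm_num
  obtain ⟨p, hdeg, hp⟩ := exists_totalDegree_le_cubeL2Norm_sub_pow_le hf hosc ha hk
    (hkε.trans (by gcongr))
  refine ⟨p, ?_, le_of_pow_le_pow_left₀ four_ne_zero h0.le (hp.trans hpow.le)⟩
  calc (p.totalDegree : ℝ) ≤ (32 * k + 9) / a + 1 := hdeg
    _ ≤ (32 * (14 * L) + 9) / a + 1 / a := by
        gcongr
        exact one_le_one_div ha ha1
    _ = (448 * L + 10) / a := by ring
    _ ≤ 500 * L / a := by
        gcongr
        linarith
    _ = 500 * ε ^ (-(4 / 5) : ℝ) * L := by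
        rw [Real.rpow_neg h0.le]
        ring

end Parameters

theorem mainTheorem1 :
    ∃ C : ℝ, 0 < C ∧
      ∀ (n : ℕ) (f : Cube n → ℝ), CubeSubmodular f → (∀ x, f x ∈ Set.Icc (0 : ℝ) 1) →
        ∀ ε : ℝ, 0 < ε → ε ≤ 1 →
          ∃ p : MvPolynomial (Fin n) ℝ,
            (p.totalDegree : ℝ) ≤ C * ε ^ (-(4 / 5) : ℝ) * Real.log (1 / ε) ∧
            cubeL2Norm (fun x => f x - polyOnCube p x) ≤ ε := by
  refine ⟨500, by norm_num, fun n f hf h01 ε h0 h1 => ?_⟩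
  rcases le_total ε (1 / 2) with h | h
  · have hosc (x y : Cube n) : f x - f y ≤ 1 := by linarith [(h01 x).2, (h01 y).1]
    exact exists_totalDegree_le_log_cubeL2Norm_sub_le hf hosc h0 h
  · refine ⟨MvPolynomial.C (1 / 2), ?_, (cubeL2Norm_le_of_abs_le fun x => ?_).trans h⟩
    · have hlog : 0 ≤ Real.log (1 / ε) := Real.log_nonneg ((one_le_div h0).2 h1)
      rw [MvPolynomial.totalDegree_C, Nat.cast_zero]
      positivity
    · rw [polyOnCube, MvPolynomial.eval_C, abs_le]
      constructor <;> linarith [(h01 x).1, (h01 x).2]
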